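/- Let $\mathbb K$ be a commutative ring with unit and let $A$ be an associative, not necessarily unital, $\mathbb K$-algebra which is idempotented: for every $a\in A$ there is an idempotent $f\in A$ with $fa=af=a$, and for any two idempotents $f_1,f_2\in A$ there is an idempotent $f\in A$ with $ff_i=f_if=f_i$ for $i=1,2$. A left $A$-module $M$ is non-degenerate if every $m\in M$ satisfies $fm=m$ for some idempotent $f\in A$. Let $\mathcal M(A)$ be the abelian category of non-degenerate left $A$-modules and $\mathcal D(A)$ its (unbounded) derived category. For an idempotent $e\in A$, let $\mathcal M(eAe)$ be the category of unital left modules over the ring $eAe$ (with unit $e$) and $\mathcal D(eAe)$ its derived category. Let $\mathcal M(A)_e\subseteq\mathcal M(A)$ be the full subcategory of those $M$ such that $e(H/L)\neq 0$ for all submodules $L\subsetneq H\subseteq M$. The idempotent $e$ is left special if the full subcategory $\{M\in\mathcal M(A)\mid M=AeM\}$ is closed under subquotients in $\mathcal M(A)$, and left split if the inclusion $\mathcal M(A)_e\to\mathcal M(A)$ preserves injective objects. Suppose that $e$ is left special and left split. The functor $M\mapsto AeM$ on $\mathcal M(A)$ is then exact; let $\Gamma_e:\mathcal D(A)\to\mathcal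 D(A)$ be its extension to the derived category, let $\mathcal D(A)_e=\{M\in\mathcal D(A)\mid \Gamma_e(M)\cong M\}$ (a full subcategory), and let $\mathrm{inc}:\mathcal D(A)_e\to\mathcal D(A)$ be the inclusion. Let $\mathrm{RHom}_A(Ae,-):\mathcal D(A)\to\mathcal D(eAe)$ and $A\otimes^{\mathrm L}_{eAe}(-):\mathcal D(eAe)\to\mathcal D(A)$ be the right derived functor of $\mathrm{Hom}_A(Ae,-)$ and the left derived functor of $A\otimes_{eAe}(-)$. Then: 1. $\Gamma_e$ and $A\otimes^{\mathrm L}_{eAe}(-)$ take values in $\mathcal D(A)_e$, so they also define functors $\Gamma_e:\mathcal D(A)\to\mathcal D(A)_e$ and $A\otimes^{\mathrm L}_{eAe}(-):\mathcal D(eAe)\to\mathcal D(A)_e$. 2. There are adjunctions (left adjoint on the left) $\mathrm{inc}\dashv\Gamma_e$ between $\mathcal D(A)_e$ and $\mathcal D(A)$; $A\otimes^{\mathrm L}_{eAe}(-)\dashv\mathrm{RHom}_A(Ae,-)$ between $\mathcal D(eAe)$ and $\mathcal D(A)$; and $A\otimes^{\mathrm L}_{eAe}(-)\dashv\mathrm{RHom}_A(Ae,-)\circ\mathrm{inc}$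 between $\mathcal D(eAe)$ and $\mathcal D(A)_e$. 3. The triangle formed by these functors commutes up to natural isomorphism: $\mathrm{RHom}_A(Ae,\mathrm{inc}\,\Gamma_e(-))\cong\mathrm{RHom}_A(Ae,-)$ on $\mathcal D(A)$; the composite of $A\otimes^{\mathrm L}_{eAe}(-):\mathcal D(eAe)\to\mathcal D(A)_e$ with $\mathrm{inc}$ is isomorphic to $A\otimes^{\mathrm L}_{eAe}(-):\mathcal D(eAe)\to\mathcal D(A)$; and $\Gamma_e\big(A\otimes^{\mathrm L}_{eAe}(-)\big)\cong A\otimes^{\mathrm L}_{eAe}(-)$ as functors $\mathcal D(eAe)\to\mathcal D(A)_e$. 4. The functor $\mathrm{RHom}_A(Ae,-):\mathcal D(A)_e\to\mathcal D(eAe)$ is an equivalence of categories, with quasi-inverse $A\otimes^{\mathrm L}_{eAe}(-):\mathcal D(eAe)\to\mathcal D(A)_e$. -/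

import Mathlib

open CategoryTheory

universe u w₁ w₂

/-- An associative (not necessarily unital) algebra `A` is idempotented if every element is fixed
on both sides by some idempotent, and any two idempotents are fixed on both sides by a common
idempotent. -/
class IsIdempotented (A : Type u) [NonUnitalRing A] : Prop where
  exists_fix : ∀ a : A, ∃ f : A, IsIdempotentElem f ∧ f * a = a ∧ a * f = a
  exists_common : ∀ f₁ f₂ : A, IsIdempotentElem f₁ → IsIdempotentElem f₂ →
    ∃ f : A, IsIdempotentElem f ∧ f * f₁ = f₁ ∧ f₁ * f = f₁ ∧ f * f₂ = f₂ ∧ f₂ * f = f₂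

namespace IdempotentedAlgebra

section

variable (K A : Type u) [CommRing K] [NonUnitalRing A] [Module K A] [IsScalarTower K A A]
  [SMulCommClass K A A]

/-! ### Modules over a non-unital algebra

A left module over the (non-unital) `K`-algebra `A` is a `K`-module with an associative `K`-bilinear
action of `A`; equivalently, a unital left module over the `K`-algebra `Unitization K A = K ⊕ A`
(`Unitization.lift`).  We work with `ModuleCat (Unitization K A)`, in which the action of `a : A` is
the action of `(a : Unitization K A)`, and the morphisms are the `A`-linear maps. -/

/-- Non-degenerate modules: every element is fixed by some idempotent of `A`. -/
def nonDegenerate : ObjectProperty (ModuleCat.{u} (Unitization K A)) :=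
  fun M => ∀ m : M, ∃ f : A, IsIdempotentElem f ∧ (f : Unitization K A) • m = m

/-- The category `M(A)` of non-degenerate left `A`-modules. -/
abbrev NDMod : Type (u + 1) := (nonDegenerate K A).FullSubcategory

instance : (nonDegenerate K A).IsClosedUnderSubobjects where
  prop_of_mono {X Y} f _ hY x := by
    obtain ⟨g, hg, h⟩ := hY (f.hom x)
    refine ⟨g, hg, (ModuleCat.mono_iff_injective f).1 inferInstance ?_⟩
    change f.hom _ = f.hom x
    rw [map_smul, h]

instance : (nonDegenerate K A).IsClosedUnderQuotients where
  prop_of_epi {X Y} f _ hX y := by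
    obtain ⟨x, rfl⟩ := (ModuleCat.epi_iff_surjective f).1 inferInstance y
    obtain ⟨g, hg, h⟩ := hX x
    refine ⟨g, hg, ?_⟩
    change _ • f.hom x = f.hom x
    rw [← map_smul, h]

instance : (nonDegenerate K A).ContainsZero where
  exists_zero := ⟨ModuleCat.of _ PUnit, ModuleCat.isZero_of_subsingleton _,
    fun _ => ⟨0, by simp [IsIdempotentElem], Subsingleton.elim _ _⟩⟩

instance [IsIdempotented A] : (nonDegenerate K A).IsClosedUnderFiniteProducts := by
  have : (nonDegenerate K A).IsClosedUnderBinaryProducts := by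
    refine ⟨?_⟩
    rintro X ⟨p⟩
    intro x
    obtain ⟨f₁, h₁, k₁⟩ := p.prop_diag_obj ⟨.left⟩ ((p.π.app ⟨.left⟩).hom x)
    obtain ⟨f₂, h₂, k₂⟩ := p.prop_diag_obj ⟨.right⟩ ((p.π.app ⟨.right⟩).hom x)
    obtain ⟨f, hf, e₁, -, e₂, -⟩ := IsIdempotented.exists_common f₁ f₂ h₁ h₂
    refine ⟨f, hf, Limits.Concrete.isLimit_ext _ p.isLimit _ _ ?_⟩
    have key : ∀ {N : ModuleCat.{u} (Unitization K A)} (φ : X ⟶ N) (g : A), f * g = g →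
        (g : Unitization K A) • φ.hom x = φ.hom x →
        φ.hom ((f : Unitization K A) • x) = φ.hom x := by
      intro N φ g h1 h2
      rw [map_smul, ← h2, ← mul_smul, ← Unitization.inr_mul, h1]
    rintro ⟨_ | _⟩
    · exact key _ _ e₁ k₁
    · exact key _ _ e₂ k₂
  exact ObjectProperty.IsClosedUnderFiniteProducts.mk'

/-! ### The submodule `AeM`, left special and left split idempotents -/

variable {A}

/-- The submodule `AeM` of `M`. -/
def genSubmodule (e : A) (M : Type u) [AddCommGroup M] [Module (Unitization K A) M] :
    Submodule (Unitization K A) M :=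
  Submodule.span (Unitization K A)
    {x | ∃ (a : A) (m : M), x = ((a * e : A) : Unitization K A) • m}

/-- The full subcategory `{M ∈ M(A) | M = AeM}`. -/
def isGenerated (e : A) : ObjectProperty (NDMod K A) :=
  fun M => genSubmodule K e M.obj = ⊤

/-- `e` is left special if `{M ∈ M(A) | M = AeM}` is closed under subquotients in `M(A)`. -/
structure LeftSpecial (e : A) : Prop where
  closedUnderSubobjects : (isGenerated K e).IsClosedUnderSubobjects
  closedUnderQuotients : (isGenerated K e).IsClosedUnderQuotients

/-- The subcategory `M(A)_e`: the non-degenerate modules `M` such that `e(H/L) ≠ 0` for all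
submodules `L < H` of `M`, that is, `e` annihilates no non-zero subquotient of `M`. -/
def isSupported (e : A) : ObjectProperty (NDMod K A) :=
  fun M => ∀ L H : Submodule (Unitization K A) M.obj, L < H →
    ∃ h ∈ H, (e : Unitization K A) • h ∉ L

/-- `e` is left split if the inclusion of `M(A)_e` in `M(A)` preserves injective objects. -/
def LeftSplit (e : A) : Prop := (isSupported K e).ι.PreservesInjectiveObjects

/-! ### Exactness in `M(A)` -/

section

variable {K} [IsIdempotented A]

/-- The linear map underlying a morphism of `M(A)`. -/
abbrev lin {M N : NDMod K A} (f : M ⟶ N) : M.obj →ₗ[Unitization K A] N.obj := f.hom.hom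

instance : (nonDegenerate K A).ι.PreservesHomology where
  preservesKernels := (nonDegenerate K A).preservesKernels_ι
  preservesCokernels := (nonDegenerate K A).preservesCokernels_ι

theorem exact_iff (S : ShortComplex (NDMod K A)) :
    S.Exact ↔ ∀ y : S.X₂.obj, lin S.g y = 0 → ∃ x : S.X₁.obj, lin S.f x = y := by
  rw [← S.exact_map_iff_of_faithful (nonDegenerate K A).ι, ShortComplex.moduleCat_exact_iff]
  rfl

end

/-! ### The functor `Γ_e : M ↦ AeM` -/

variable {K}

theorem nonDegenerate_submodule (M : NDMod K A) (H : Submodule (Unitization K A) M.obj) :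
    nonDegenerate K A (ModuleCat.of _ H) := fun m => by
  obtain ⟨f, hf, h⟩ := M.property m
  exact ⟨f, hf, Subtype.ext h⟩

/-- A submodule of a non-degenerate module, as an object of `M(A)`. -/
abbrev subobj (M : NDMod K A) (H : Submodule (Unitization K A) M.obj) : NDMod K A :=
  ⟨ModuleCat.of _ H, nonDegenerate_submodule M H⟩

theorem genSubmodule_le_comap (e : A) {M N : NDMod K A} (f : M ⟶ N) :
    genSubmodule K e M.obj ≤ (genSubmodule K e N.obj).comap f.hom.hom := by
  refine Submodule.span_le.2 ?_
  rintro _ ⟨a, m, rfl⟩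
  exact Submodule.subset_span ⟨a, f.hom.hom m, map_smul _ _ _⟩

variable (K) in
/-- The functor `M ↦ AeM` from `M(A)` to itself, acting on morphisms by restriction. -/
def gamma (e : A) : NDMod K A ⥤ NDMod K A where
  obj M := subobj M (genSubmodule K e M.obj)
  map f := ObjectProperty.homMk (ModuleCat.ofHom
    (f.hom.hom.restrict (genSubmodule_le_comap e f)))

instance [IsIdempotented A] (e : A) : (gamma K e).Additive where

theorem smul_mem_genSubmodule {e : A} (he : IsIdempotentElem e) (M : NDMod K A) (m : M.obj) :
    (e : Unitization K A) • m ∈ genSubmodule K e M.obj :=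
  Submodule.subset_span ⟨e, m, by rw [he.eq]⟩

/-- If `e` is left special, every submodule `H` of `AeM` is generated by `eH`. -/
theorem LeftSpecial.le_of_smul_mem {e : A} (hs : LeftSpecial K e) (he : IsIdempotentElem e)
    (M : NDMod K A) (H P : Submodule (Unitization K A) M.obj) (hH : H ≤ genSubmodule K e M.obj)
    (hP : ∀ h ∈ H, (e : Unitization K A) • h ∈ P) : H ≤ P := by
  have h0 : isGenerated K e (subobj M (genSubmodule K e M.obj)) := by
    rw [isGenerated, eq_top_iff]
    rintro ⟨x, hx⟩ -
    induction hx using Submodule.span_induction with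
    | mem x hx =>
      obtain ⟨a, m, rfl⟩ := hx
      refine Submodule.subset_span ⟨a, ⟨_, smul_mem_genSubmodule he M m⟩, Subtype.ext ?_⟩
      change _ = ((a * e : A) : Unitization K A) • (e : Unitization K A) • m
      rw [← mul_smul, ← Unitization.inr_mul, mul_assoc, he.eq]
    | zero => exact zero_mem _
    | add x y hx hy h1 h2 => exact add_mem h1 h2
    | smul r x hx h1 => exact Submodule.smul_mem _ r h1
  have := hs.closedUnderSubobjects
  let i : subobj M H ⟶ subobj M (genSubmodule K e M.obj) :=
    ObjectProperty.homMk (ModuleCat.ofHom (Submodule.inclusion hH))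
  have : Mono i := (nonDegenerate K A).ι.mono_of_mono_map
    ((ModuleCat.mono_iff_injective _).2 (Submodule.inclusion_injective hH))
  have h1 : isGenerated K e (subobj M H) := (isGenerated K e).prop_of_mono i h0
  have h2 : genSubmodule K e (subobj M H).obj ≤ P.comap H.subtype := by
    refine Submodule.span_le.2 ?_
    rintro _ ⟨a, m, rfl⟩
    change ((a * e : A) : Unitization K A) • (m : M.obj) ∈ P
    rw [Unitization.inr_mul, mul_smul]
    exact P.smul_mem _ (hP _ m.2)
  intro x hx
  exact h2 (h1.ge (Submodule.mem_top (x := (⟨x, hx⟩ : H))))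

theorem gamma_exact [IsIdempotented A] {e : A} (hs : LeftSpecial K e) (he : IsIdempotentElem e)
    (S : ShortComplex (NDMod K A)) (hS : S.Exact) : (S.map (gamma K e)).Exact := by
  rw [exact_iff] at hS ⊢
  rintro ⟨y, hy⟩ hgy
  have hgy' : lin S.g y = 0 := congrArg Subtype.val hgy
  obtain ⟨x, hx, hxy⟩ := hs.le_of_smul_mem he S.X₂
    (genSubmodule K e S.X₂.obj ⊓ LinearMap.ker (lin S.g))
    ((genSubmodule K e S.X₁.obj).map (lin S.f)) inf_le_left (by
      rintro h ⟨-, hh⟩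
      obtain ⟨m, rfl⟩ := hS h hh
      exact ⟨_, smul_mem_genSubmodule he _ m, map_smul _ _ _⟩) ⟨hy, hgy'⟩
  exact ⟨⟨x, hx⟩, Subtype.ext hxy⟩

/-! ### The functor `Hom_A(Ae, -)` -/

instance : Module (Unitization K A) A where
  smul r x := r.fst • x + r.snd * x
  one_smul x := by change (1 : Unitization K A).fst • x + (1 : Unitization K A).snd * x = x; simp
  mul_smul r s x := by
    change (r * s).fst • x + (r * s).snd * x =
      r.fst • (s.fst • x + s.snd * x) + r.snd * (s.fst • x + s.snd * x)
    simp [add_mul, mul_add, mul_smul, mul_assoc, smul_mul_assoc, mul_smul_comm]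
    abel
  smul_zero r := by change r.fst • (0 : A) + r.snd * 0 = 0; simp
  smul_add r x y := by
    change r.fst • (x + y) + r.snd * (x + y) = r.fst • x + r.snd * x + (r.fst • y + r.snd * y)
    rw [smul_add, mul_add]; abel
  add_smul r s x := by
    change (r + s).fst • x + (r + s).snd * x = r.fst • x + r.snd * x + (s.fst • x + s.snd * x)
    rw [Unitization.fst_add, Unitization.snd_add, add_smul, add_mul]; abel
  zero_smul x := by
    change (0 : Unitization K A).fst • x + (0 : Unitization K A).snd * x = 0; simp

theorem inr_smul_self (a x : A) : (a : Unitization K A) • x = a * x := by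
  change (a : Unitization K A).fst • x + (a : Unitization K A).snd * x = a * x
  simp

variable (K) in
/-- Right multiplication by `x`, as an endomorphism of the left `A`-module `A`. -/
def rightMul (x : A) : A →ₗ[Unitization K A] A where
  toFun y := y * x
  map_add' y z := add_mul y z x
  map_smul' r y := by
    change (r.fst • y + r.snd * y) * x = r.fst • (y * x) + r.snd * (y * x)
    rw [add_mul, smul_mul_assoc, mul_assoc]

variable (K) in
/-- The left `A`-module `Ae`. -/
def leftIdeal (e : A) : Submodule (Unitization K A) A := LinearMap.range (rightMul K e)

theorem mul_mem_leftIdeal {e : A} {he : IsIdempotentElem e} (y : A) (x : he.Corner) :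
    y * x.1 ∈ leftIdeal K e :=
  ⟨y * x.1, by
    change y * x.1 * e = y * x.1
    rw [mul_assoc, ((Subsemigroup.mem_corner_iff he).1 x.2).2]⟩

theorem mul_eq_of_mem_leftIdeal {e : A} (he : IsIdempotentElem e) {y : A}
    (hy : y ∈ leftIdeal K e) : y * e = y := by
  obtain ⟨a, rfl⟩ := hy
  change a * e * e = a * e
  rw [mul_assoc, he.eq]

theorem self_mem_leftIdeal {e : A} (he : IsIdempotentElem e) : e ∈ leftIdeal K e := ⟨e, he.eq⟩

variable (K) in
/-- Right multiplication by `x ∈ eAe` on `Ae`. -/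
def rightMulCorner {e : A} {he : IsIdempotentElem e} (x : he.Corner) :
    leftIdeal K e →ₗ[Unitization K A] leftIdeal K e :=
  (rightMul K x.1).restrict fun y _ => mul_mem_leftIdeal y x

/-- The left `eAe`-module structure on `Hom_A(Ae, M)`, given by `(x • φ) y = φ (y * x)`. -/
instance {e : A} {he : IsIdempotentElem e} (M : Type u) [AddCommGroup M]
    [Module (Unitization K A) M] : Module he.Corner (leftIdeal K e →ₗ[Unitization K A] M) where
  smul x φ := φ ∘ₗ rightMulCorner K x
  one_smul φ := LinearMap.ext fun y =>
    congrArg φ (Subtype.ext (mul_eq_of_mem_leftIdeal he y.2))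
  mul_smul x x' φ := LinearMap.ext fun y =>
    congrArg φ (Subtype.ext (mul_assoc y.1 x.1 x'.1).symm)
  smul_zero _ := rfl
  smul_add _ _ _ := rfl
  add_smul x x' φ := LinearMap.ext fun y =>
    (congrArg φ (Subtype.ext (mul_add y.1 x.1 x'.1))).trans (map_add φ _ _)
  zero_smul φ := LinearMap.ext fun y =>
    (congrArg φ (Subtype.ext (mul_zero y.1))).trans (map_zero φ)

variable (K) in
/-- The functor `Hom_A(Ae, -)` from `M(A)` to `M(eAe)`.  As `eAe` is unital with unit `e`, its
non-degenerate modules are the unital modules over the ring `eAe`. -/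
def homAe {e : A} (he : IsIdempotentElem e) : NDMod K A ⥤ ModuleCat.{u} he.Corner where
  obj M := ModuleCat.of he.Corner (leftIdeal K e →ₗ[Unitization K A] M.obj)
  map f := ModuleCat.ofHom
    { toFun := fun φ => f.hom.hom ∘ₗ φ
      map_add' := fun φ ψ => LinearMap.comp_add φ ψ f.hom.hom
      map_smul' := fun _ _ => rfl }

instance [IsIdempotented A] {e : A} (he : IsIdempotentElem e) : (homAe K he).Additive where

theorem homAe_exact [IsIdempotented A] {e : A} (he : IsIdempotentElem e)
    (S : ShortComplex (NDMod K A)) (hS : S.Exact) : (S.map (homAe K he)).Exact := by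
  rw [exact_iff] at hS
  rw [ShortComplex.moduleCat_exact_iff]
  intro (φ : leftIdeal K e →ₗ[Unitization K A] S.X₂.obj) hφ
  have hφ' : lin S.g ∘ₗ φ = 0 := hφ
  obtain ⟨x, hx⟩ := hS (φ ⟨e, self_mem_leftIdeal he⟩) (LinearMap.congr_fun hφ' _)
  let ψ : A →ₗ[Unitization K A] S.X₁.obj :=
    { toFun := fun y => (y : Unitization K A) • x
      map_add' := fun y z => by rw [Unitization.inr_add, add_smul]
      map_smul' := fun r y => by
        rw [RingHom.id_apply, ← mul_smul]
        congr 1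
        refine Unitization.ext (by simp) ?_
        change r.fst • y + r.snd * y = _
        simp }
  refine ⟨ψ ∘ₗ (leftIdeal K e).subtype, LinearMap.ext fun y => ?_⟩
  change lin S.f ((y.1 : Unitization K A) • x) = φ y
  rw [map_smul, hx, ← map_smul]
  congr 1
  refine Subtype.ext ?_
  change (y.1 : Unitization K A) • e = y.1
  rw [inr_smul_self, mul_eq_of_mem_leftIdeal he y.2]

/-! ### The functor `A ⊗_{eAe} -` -/

section

open TensorProduct

variable (K) in
/-- The relations `ax ⊗ n = a ⊗ xn` for `a ∈ A`, `x ∈ eAe`, `n ∈ N`. -/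
def tensorRel {e : A} (he : IsIdempotentElem e) (N : Type u) [AddCommGroup N]
    [Module he.Corner N] : Submodule (Unitization K A) (A ⊗[ℤ] N) :=
  Submodule.span (Unitization K A)
    {z | ∃ (a : A) (x : he.Corner) (n : N), z = (a * x.1) ⊗ₜ[ℤ] n - a ⊗ₜ[ℤ] (x • n)}

variable (K) in
/-- The left `A`-module `A ⊗_{eAe} N`. -/
abbrev tensorObj {e : A} (he : IsIdempotentElem e) (N : Type u) [AddCommGroup N]
    [Module he.Corner N] : Type u := (A ⊗[ℤ] N) ⧸ tensorRel K he N

variable (K) in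
/-- The class of `a ⊗ n` in `A ⊗_{eAe} N`. -/
abbrev tmk {e : A} (he : IsIdempotentElem e) {N : Type u} [AddCommGroup N]
    [Module he.Corner N] (a : A) (n : N) : tensorObj K he N :=
  Submodule.Quotient.mk (a ⊗ₜ[ℤ] n)

theorem smul_tmk {e : A} (he : IsIdempotentElem e) {N : Type u} [AddCommGroup N]
    [Module he.Corner N] (b a : A) (n : N) :
    (b : Unitization K A) • tmk K he a n = tmk K he (b * a) n := by
  rw [← inr_smul_self (K := K) b a]; rfl

theorem tmk_mul {e : A} (he : IsIdempotentElem e) {N : Type u} [AddCommGroup N]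
    [Module he.Corner N] (a : A) (x : he.Corner) (n : N) :
    tmk K he (a * x.1) n = tmk K he a (x • n) :=
  (Submodule.Quotient.eq _).2 (Submodule.subset_span ⟨a, x, n, rfl⟩)

theorem tensorObj_induction {e : A} (he : IsIdempotentElem e) {N : Type u} [AddCommGroup N]
    [Module he.Corner N] {p : tensorObj K he N → Prop} (z : tensorObj K he N)
    (h0 : p 0) (ht : ∀ a n, p (tmk K he a n)) (ha : ∀ y z, p y → p z → p (y + z)) : p z := by
  obtain ⟨z, rfl⟩ := Submodule.Quotient.mk_surjective _ z
  induction z using TensorProduct.induction_on with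
  | zero => exact h0
  | tmul a n => exact ht a n
  | add y z hy hz => exact ha _ _ hy hz

theorem nonDegenerate_tensorObj [IsIdempotented A] {e : A} (he : IsIdempotentElem e) (N : Type u)
    [AddCommGroup N] [Module he.Corner N] :
    nonDegenerate K A (ModuleCat.of _ (tensorObj K he N)) := by
  intro (z : tensorObj K he N)
  change ∃ f : A, IsIdempotentElem f ∧ (f : Unitization K A) • z = z
  induction z using tensorObj_induction he with
  | h0 => exact ⟨0, by simp [IsIdempotentElem], by simp⟩
  | ht a n =>
    obtain ⟨f, hf, h, -⟩ := IsIdempotented.exists_fix a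
    exact ⟨f, hf, by rw [smul_tmk, h]⟩
  | ha y z hy hz =>
    obtain ⟨f₁, h₁, k₁⟩ := hy
    obtain ⟨f₂, h₂, k₂⟩ := hz
    obtain ⟨f, hf, e₁, -, e₂, -⟩ := IsIdempotented.exists_common f₁ f₂ h₁ h₂
    refine ⟨f, hf, ?_⟩
    rw [smul_add]
    conv_lhs => rw [← k₁, ← k₂]
    rw [← mul_smul, ← mul_smul, ← Unitization.inr_mul, ← Unitization.inr_mul, e₁, e₂, k₁, k₂]

variable (K) in
/-- The map `id ⊗ f : A ⊗_{eAe} N → A ⊗_{eAe} N'` induced by an `eAe`-linear map `f`. -/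
def tensorMap {e : A} (he : IsIdempotentElem e) {N N' : Type u} [AddCommGroup N]
    [Module he.Corner N] [AddCommGroup N'] [Module he.Corner N'] (f : N →ₗ[he.Corner] N') :
    tensorObj K he N →ₗ[Unitization K A] tensorObj K he N' :=
  (tensorRel K he N).mapQ (tensorRel K he N')
    (TensorProduct.AlgebraTensorModule.map LinearMap.id f.toAddMonoidHom.toIntLinearMap) (by
      refine Submodule.span_le.2 ?_
      rintro _ ⟨a, x, n, rfl⟩
      refine Submodule.subset_span ⟨a, x, f n, ?_⟩
      rw [map_sub, ← map_smul]
      rfl)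

theorem tensorMap_tmk {e : A} (he : IsIdempotentElem e) {N N' : Type u} [AddCommGroup N]
    [Module he.Corner N] [AddCommGroup N'] [Module he.Corner N'] (f : N →ₗ[he.Corner] N')
    (a : A) (n : N) : tensorMap K he f (tmk K he a n) = tmk K he a (f n) := rfl

theorem tensorMap_id {e : A} (he : IsIdempotentElem e) (N : Type u) [AddCommGroup N]
    [Module he.Corner N] : tensorMap K he (LinearMap.id : N →ₗ[he.Corner] N) = LinearMap.id := by
  refine LinearMap.ext fun z => ?_
  induction z using tensorObj_induction he with
  | h0 => rfl
  | ht a n => rfl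
  | ha y z hy hz => rw [map_add, hy, hz, map_add]

theorem tensorMap_comp {e : A} (he : IsIdempotentElem e) {N N' N'' : Type u} [AddCommGroup N]
    [Module he.Corner N] [AddCommGroup N'] [Module he.Corner N'] [AddCommGroup N'']
    [Module he.Corner N''] (f : N →ₗ[he.Corner] N') (g : N' →ₗ[he.Corner] N'') :
    tensorMap K he (g ∘ₗ f) = tensorMap K he g ∘ₗ tensorMap K he f := by
  refine LinearMap.ext fun z => ?_
  induction z using tensorObj_induction he with
  | h0 => simp only [map_zero]
  | ht a n => rfl
  | ha y z hy hz => rw [map_add, hy, hz, map_add]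

theorem tensorMap_add {e : A} (he : IsIdempotentElem e) {N N' : Type u} [AddCommGroup N]
    [Module he.Corner N] [AddCommGroup N'] [Module he.Corner N'] (f g : N →ₗ[he.Corner] N') :
    tensorMap K he (f + g) = tensorMap K he f + tensorMap K he g := by
  refine LinearMap.ext fun z => ?_
  induction z using tensorObj_induction he with
  | h0 => simp only [map_zero]
  | ht a n =>
    rw [LinearMap.add_apply, tensorMap_tmk, tensorMap_tmk, tensorMap_tmk, LinearMap.add_apply,
      tmk, TensorProduct.tmul_add, Submodule.Quotient.mk_add]
  | ha y z hy hz => rw [map_add, hy, hz, map_add]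

variable (K) in
/-- The functor `A ⊗_{eAe} -` from `M(eAe)` to `M(A)`. -/
def tensor [IsIdempotented A] {e : A} (he : IsIdempotentElem e) :
    ModuleCat.{u} he.Corner ⥤ NDMod K A where
  obj N := ⟨ModuleCat.of _ (tensorObj K he N), nonDegenerate_tensorObj he N⟩
  map f := ObjectProperty.homMk (ModuleCat.ofHom (tensorMap K he f.hom))
  map_id N := congrArg (fun φ => ObjectProperty.homMk (ModuleCat.ofHom φ)) (tensorMap_id he N)
  map_comp f g :=
    congrArg (fun φ => ObjectProperty.homMk (ModuleCat.ofHom φ)) (tensorMap_comp he f.hom g.hom)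

instance [IsIdempotented A] {e : A} (he : IsIdempotentElem e) : (tensor K he).Additive where
  map_add {_ _ f g} :=
    congrArg (fun φ => ObjectProperty.homMk (ModuleCat.ofHom φ)) (tensorMap_add he f.hom g.hom)

/-- The element `eae` of `eAe`. -/
def toCorner {e : A} (he : IsIdempotentElem e) : A →+ he.Corner where
  toFun a := ⟨e * a * e, a, rfl⟩
  map_zero' := Subtype.ext (by change e * 0 * e = 0; simp)
  map_add' a b := Subtype.ext (by
    change e * (a + b) * e = e * a * e + e * b * e
    rw [mul_add, add_mul])

theorem toCorner_mul {e : A} (he : IsIdempotentElem e) (a : A) (x : he.Corner) :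
    toCorner he (a * x.1) = toCorner he a * x := Subtype.ext (by
  change e * (a * x.1) * e = e * a * e * x.1
  obtain ⟨h1, h2⟩ := (Subsemigroup.mem_corner_iff he).1 x.2
  rw [mul_assoc (e * a), h1, mul_assoc, mul_assoc, h2, mul_assoc])

/-- The additive map `A ⊗ N → N` with `a ⊗ n ↦ (e b a e) n`. -/
def cornerMap {e : A} (he : IsIdempotentElem e) (N : Type u) [AddCommGroup N]
    [Module he.Corner N] (b : A) : A ⊗[ℤ] N →+ N :=
  TensorProduct.liftAddHom
    { toFun := fun a => DistribSMul.toAddMonoidHom N (toCorner he (b * a))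
      map_zero' := by ext; simp
      map_add' := fun x y => by ext; simp [mul_add, add_smul] }
    (fun r a n => by
      change toCorner he (b * r • a) • n = toCorner he (b * a) • r • n
      rw [mul_smul_comm, map_zsmul, smul_assoc, smul_comm])

theorem cornerMap_tmul {e : A} (he : IsIdempotentElem e) (N : Type u) [AddCommGroup N]
    [Module he.Corner N] (b a : A) (n : N) :
    cornerMap he N b (a ⊗ₜ n) = toCorner he (b * a) • n := rfl

theorem cornerMap_smul {e : A} (he : IsIdempotentElem e) (N : Type u) [AddCommGroup N]
    [Module he.Corner N] (b : A) (r : Unitization K A) (z : A ⊗[ℤ] N) :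
    cornerMap he N b (r • z) = cornerMap he N (r.fst • b + b * r.snd) z := by
  induction z using TensorProduct.induction_on with
  | zero => simp
  | tmul a n =>
    change cornerMap he N b ((r.fst • a + r.snd * a) ⊗ₜ n) = _
    rw [cornerMap_tmul, cornerMap_tmul, mul_add, add_mul, mul_smul_comm, smul_mul_assoc, mul_assoc]
  | add y z hy hz => rw [smul_add, map_add, hy, hz, map_add]

theorem cornerMap_eq_zero {e : A} (he : IsIdempotentElem e) (N : Type u) [AddCommGroup N]
    [Module he.Corner N] (b : A) (z : A ⊗[ℤ] N) (hz : z ∈ tensorRel K he N) :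
    cornerMap he N b z = 0 := by
  induction hz using Submodule.span_induction generalizing b with
  | mem z hz =>
    obtain ⟨a, x, n, rfl⟩ := hz
    rw [map_sub, cornerMap_tmul, cornerMap_tmul, ← mul_assoc, toCorner_mul, mul_smul, sub_self]
  | zero => exact map_zero _
  | add y z _ _ hy hz => rw [map_add, hy, hz, add_zero]
  | smul r z _ hz => rw [cornerMap_smul, hz]

theorem smul_eq_tmk {e : A} (he : IsIdempotentElem e) (N : Type u) [AddCommGroup N]
    [Module he.Corner N] (z : A ⊗[ℤ] N) :
    (e : Unitization K A) • (Submodule.Quotient.mk z : tensorObj K he N) =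
      tmk K he e (cornerMap he N e z) := by
  induction z using TensorProduct.induction_on with
  | zero => simp [tmk]
  | tmul a n =>
    rw [cornerMap_tmul, ← tmk_mul, smul_tmk]
    change _ = tmk K he (e * (e * (e * a) * e)) n
    have h1 : (1 : he.Corner) • n = n := one_smul _ n
    conv_lhs => rw [← h1, ← tmk_mul]
    change tmk K he (e * a * e) n = _
    congr 1
    simp only [← mul_assoc, he.eq]
  | add y z hy hz =>
    rw [Submodule.Quotient.mk_add, smul_add, hy, hz, map_add, tmk, tmk, tmk,
      TensorProduct.tmul_add]
    rfl

theorem tensorObj_generated [IsIdempotented A] {e : A} (he : IsIdempotentElem e)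
    (N : ModuleCat.{u} he.Corner) : isGenerated K e ((tensor K he).obj N) := by
  rw [isGenerated, eq_top_iff]
  intro (z : tensorObj K he N) _
  induction z using tensorObj_induction he with
  | h0 => exact zero_mem _
  | ha y z hy hz => exact add_mem (hy trivial) (hz trivial)
  | ht a n =>
    refine Submodule.subset_span ⟨a, tmk K he e n, ?_⟩
    have h1 : (1 : he.Corner) • n = n := one_smul _ n
    have h2 : tmk K he a n = tmk K he (a * e) n := by
      conv_lhs => rw [← h1, ← tmk_mul]
      rfl
    have h3 := smul_tmk (K := K) he (a * e) e n
    rw [mul_assoc, he.eq, ← h2] at h3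
    exact h3.symm

theorem tensor_exact [IsIdempotented A] {e : A} (hs : LeftSpecial K e) (he : IsIdempotentElem e)
    (S : ShortComplex (ModuleCat.{u} he.Corner)) (hS : S.Exact) :
    (S.map (tensor K he)).Exact := by
  rw [ShortComplex.moduleCat_exact_iff] at hS
  rw [exact_iff]
  intro y hy
  refine hs.le_of_smul_mem he ((tensor K he).obj S.X₂) (LinearMap.ker (tensorMap K he S.g.hom))
    (LinearMap.range (tensorMap K he S.f.hom)) ?_ ?_ hy
  · rw [tensorObj_generated he S.X₂]; exact le_top
  · intro (h : tensorObj K he S.X₂) hh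
    obtain ⟨z, rfl⟩ := Submodule.Quotient.mk_surjective _ h
    have nat : ∀ z : A ⊗[ℤ] S.X₂, S.g.hom (cornerMap he S.X₂ e z) =
        cornerMap he S.X₃ e (TensorProduct.AlgebraTensorModule.map
          (LinearMap.id : A →ₗ[Unitization K A] A) S.g.hom.toAddMonoidHom.toIntLinearMap z) := by
      intro z
      induction z using TensorProduct.induction_on with
      | zero => simp
      | tmul a n => exact map_smul S.g.hom _ _
      | add y z hy hz => simp only [map_add, hy, hz]
    have h0 : S.g.hom (cornerMap he S.X₂ e z) = 0 := by
      rw [nat]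
      exact cornerMap_eq_zero (K := K) he _ e _ ((Submodule.Quotient.mk_eq_zero _).1 hh)
    obtain ⟨n, hn⟩ := hS _ h0
    refine ⟨tmk K he e n, ?_⟩
    refine Eq.trans ?_ (smul_eq_tmk (K := K) he S.X₂ z).symm
    exact congrArg (tmk K he e) hn

end

/-! ### Derived functors -/

section

variable {C D : Type (u + 1)} [Category.{u} C] [Abelian C] [Category.{u} D] [Abelian D]

/-- The functor `C(F) : C(C) ⥤ C(D)` induced on cochain complexes by an additive functor `F`,
followed by the localization functor `C(D) ⥤ D(D)`. -/
noncomputable abbrev toDerived [HasDerivedCategory.{w₂} D] (F : C ⥤ D) [F.Additive] :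
    CochainComplex C ℤ ⥤ DerivedCategory D :=
  F.mapHomologicalComplex (ComplexShape.up ℤ) ⋙ DerivedCategory.Q

theorem preservesFinite_of_exact (F : C ⥤ D) [F.Additive]
    (hF : ∀ S : ShortComplex C, S.Exact → (S.map F).Exact) :
    Limits.PreservesFiniteLimits F ∧ Limits.PreservesFiniteColimits F :=
  (F.exact_tfae.out 1 3).1 hF

theorem hasRightDerivedFunctor_of_exact [HasDerivedCategory.{w₁} C] [HasDerivedCategory.{w₂} D]
    (F : C ⥤ D) [F.Additive] (hF : ∀ S : ShortComplex C, S.Exact → (S.map F).Exact) :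
    (toDerived F).HasRightDerivedFunctor
      (HomologicalComplex.quasiIso C (ComplexShape.up ℤ)) := by
  obtain ⟨_, _⟩ := preservesFinite_of_exact F hF
  have := Functor.isRightDerivedFunctor_of_inverts
    (HomologicalComplex.quasiIso C (ComplexShape.up ℤ)) F.mapDerivedCategory
    F.mapDerivedCategoryFactors
  exact Functor.HasRightDerivedFunctor.mk' F.mapDerivedCategory F.mapDerivedCategoryFactors.inv

theorem hasLeftDerivedFunctor_of_exact [HasDerivedCategory.{w₁} C] [HasDerivedCategory.{w₂} D]
    (F : C ⥤ D) [F.Additive] (hF : ∀ S : ShortComplex C, S.Exact → (S.map F).Exact) :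
    (toDerived F).HasLeftDerivedFunctor
      (HomologicalComplex.quasiIso C (ComplexShape.up ℤ)) := by
  obtain ⟨_, _⟩ := preservesFinite_of_exact F hF
  have := Functor.isLeftDerivedFunctor_of_inverts
    (HomologicalComplex.quasiIso C (ComplexShape.up ℤ)) F.mapDerivedCategory
    F.mapDerivedCategoryFactors
  exact Functor.HasLeftDerivedFunctor.mk' F.mapDerivedCategory F.mapDerivedCategoryFactors.hom

end

section

variable [IsIdempotented A] [HasDerivedCategory.{w₁} (NDMod K A)] {e : A}
  (he : IsIdempotentElem e) (hs : LeftSpecial K e)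

/-- The extension `Γ_e : D(A) ⥤ D(A)` of the exact functor `M ↦ AeM`. -/
noncomputable def derivedGamma : DerivedCategory (NDMod K A) ⥤ DerivedCategory (NDMod K A) :=
  have := (preservesFinite_of_exact _ (gamma_exact hs he)).1
  have := (preservesFinite_of_exact _ (gamma_exact hs he)).2
  (gamma K e).mapDerivedCategory

/-- The full subcategory `D(A)_e = {M ∈ D(A) | Γ_e(M) ≅ M}`. -/
def isDerivedSupported : ObjectProperty (DerivedCategory (NDMod K A)) :=
  fun M => Nonempty ((derivedGamma he hs).obj M ≅ M)

/-- The category `D(A)_e`. -/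
abbrev DerivedSupported := (isDerivedSupported he hs).FullSubcategory

variable (K) in
/-- `RHom_A(Ae, -) : D(A) ⥤ D(eAe)`, the total right derived functor of `Hom_A(Ae, -)`. -/
noncomputable def derivedHom [HasDerivedCategory.{w₂} (ModuleCat.{u} he.Corner)] :
    DerivedCategory (NDMod K A) ⥤ DerivedCategory (ModuleCat.{u} he.Corner) :=
  have := hasRightDerivedFunctor_of_exact _ (homAe_exact (K := K) he)
  (toDerived (homAe K he)).totalRightDerived DerivedCategory.Q
    (HomologicalComplex.quasiIso _ (ComplexShape.up ℤ))

/-- `A ⊗^L_{eAe} - : D(eAe) ⥤ D(A)`, the total left derived functor of `A ⊗_{eAe} -`. -/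
noncomputable def derivedTensor [HasDerivedCategory.{w₂} (ModuleCat.{u} he.Corner)] :
    DerivedCategory (ModuleCat.{u} he.Corner) ⥤ DerivedCategory (NDMod K A) :=
  have := hasLeftDerivedFunctor_of_exact _ (tensor_exact hs he)
  (toDerived (tensor K he)).totalLeftDerived DerivedCategory.Q
    (HomologicalComplex.quasiIso _ (ComplexShape.up ℤ))

end

end

end IdempotentedAlgebra

open IdempotentedAlgebra

/-! Write `T = A ⊗_{eAe} -` and `H = Hom_A(Ae, -)`. The theorem holds already at the level of
abelian categories, and it passes to derived categories because every functor involved is exact.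

A homomorphism out of `Ae` is determined by its value at `e`, so `H(M)` is `eM`. This makes `H`
exact and right adjoint to `T`. The unit `N → HTN` is bijective because `e(A ⊗_{eAe} N)` is a copy
of `N` (`tensorUnit_bijective`). The counit `THM → M` sends `a ⊗ φ` to `aφ(e)`. Its image is `AeM`
(`range_tensorCounit`). Its kernel is annihilated by `e`, and since `THM` is generated by its
`e`-part, left speciality forces the kernel to vanish (`tensorCounit_injective`). Hence `Γ_e ≅ TH`
(`isIso_tensorHomToGamma`). Left speciality also makes `T` and `Γ_e` exact.

The derived functors of exact functors are their termwise extensions, so the adjunction, the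
invertible unit and the isomorphism `Γ_e ≅ TH` all descend to the derived categories. The rest is
formal (`exists_equivalence_of_adj`): a left adjoint with invertible unit is fully faithful, and its
essential image consists of the objects `X` with `THX ≅ X`, here `D(A)_e`. -/

namespace CategoryTheory

/-! ### Coreflections onto the objects isomorphic to their coreflection -/

section Coreflection

variable {C : Type*} {D : Type*} [Category* C] [Category* D] {T : D ⥤ C} {H : C ⥤ D} {G : C ⥤ C}

/-- The objects `X` such that there is an isomorphism `G.obj X ≅ X`. -/
abbrev isoFixed (G : C ⥤ C) : ObjectProperty C := fun X => Nonempty (G.obj X ≅ X)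

/-- `GTY ≅ THTY ≅ TY`, the second isomorphism being the inverse of the unit under `T`. -/
theorem isoFixed_obj_of_adj (adj : T ⊣ H) [IsIso adj.unit] (i : G ≅ H ⋙ T) (Y : D) :
    isoFixed G (T.obj Y) :=
  ⟨i.app _ ≪≫ T.mapIso (asIso (adj.unit.app Y)).symm⟩

theorem isoFixed_of_adj (adj : T ⊣ H) [IsIso adj.unit] (i : G ≅ H ⋙ T) (X : C) :
    isoFixed G (G.obj X) :=
  ⟨G.mapIso (i.app X) ≪≫ (isoFixed_obj_of_adj adj i (H.obj X)).some ≪≫ (i.app X).symm⟩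

/-- If `T` is fully faithful with right adjoint `H`, and `G ≅ H ⋙ T`, then `T` is an equivalence
onto the full subcategory of the objects `X` with `G.obj X ≅ X`, and this subcategory is
coreflective with coreflector `G`. -/
theorem exists_equivalence_of_adj (adj : T ⊣ H) [IsIso adj.unit] (i : G ≅ H ⋙ T)
    {P : ObjectProperty C} (hP : P = isoFixed G) :
    ∃ (hG : ∀ X, P (G.obj X)) (hT : ∀ Y, P (T.obj Y)),
      Nonempty (P.ι ⊣ P.lift G hG) ∧
      Nonempty (P.lift T hT ⊣ P.ι ⋙ H) ∧
      Nonempty (P.lift G hG ⋙ P.ι ⋙ H ≅ H) ∧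
      Nonempty (P.lift T hT ⋙ P.ι ≅ T) ∧
      Nonempty (T ⋙ P.lift G hG ≅ P.lift T hT) ∧
      ∃ E : P.FullSubcategory ≌ D, E.functor = P.ι ⋙ H ∧ E.inverse = P.lift T hT := by
  subst hP
  have : T.Full := adj.fullyFaithfulLOfIsIsoUnit.full
  have : T.Faithful := adj.fullyFaithfulLOfIsIsoUnit.faithful
  let P : ObjectProperty C := isoFixed G
  let hG := isoFixed_of_adj adj i
  let hT := isoFixed_obj_of_adj adj i
  let adj' : P.lift T hT ⊣ P.ι ⋙ H :=
    adj.restrictFullyFaithful (Functor.FullyFaithful.id D) P.fullyFaithfulι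
      (L := P.lift T hT) (R := P.ι ⋙ H) (Iso.refl T) (Iso.refl (P.ι ⋙ H))
  -- If `GX ≅ X`, then `X ≅ THX` lies in the essential image of `T`.
  have : (P.lift T hT).EssSurj :=
    ⟨fun X => ⟨H.obj X.obj, ⟨P.isoMk ((i.app X.obj).symm ≪≫ X.property.some)⟩⟩⟩
  have : (P.lift T hT).IsEquivalence := { }
  have : (P.ι ⋙ H).IsEquivalence := adj'.isEquivalence_right_of_isEquivalence_left
  let E : P.FullSubcategory ≌ D := adj'.toEquivalence.symm
  -- The isomorphism `GX ≅ X` is arbitrary and need not come from the counit. Since `T` is fully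
  -- faithful, any isomorphism of `X` with an object in its image still makes the counit at `X`
  -- invertible.
  have hc : ∀ X : P.FullSubcategory, IsIso (adj.counit.app X.obj) := fun X =>
    adj.isIso_counit_app_of_iso (X.property.some.symm ≪≫ i.app X.obj)
  let j : (P.ι ⋙ H) ⋙ T ≅ P.ι :=
    NatIso.ofComponents (fun X => have := hc X; asIso (adj.counit.app X.obj))
      (fun f => adj.counit.naturality f.hom)
  let k : H ⋙ P.lift T hT ≅ P.lift G hG :=
    NatIso.ofComponents (fun X => P.isoMk (i.symm.app X))
      (fun f => P.hom_ext (i.inv.naturality f))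
  -- Composing the equivalence `P ≌ D` with `T ⊣ H` gives an adjunction whose left adjoint is the
  -- inclusion, by the counit (`j`), and whose right adjoint is `G`, by `i` (`k`).
  refine ⟨hG, hT, ⟨((E.toAdjunction.comp adj).ofNatIsoLeft j).ofNatIsoRight k⟩, ⟨adj'⟩,
    ⟨Functor.isoWhiskerRight i H ≪≫ Functor.isoWhiskerLeft H (asIso adj.unit).symm⟩,
    ⟨Iso.refl _⟩, ⟨?_⟩, E, rfl, rfl⟩
  exact Functor.isoWhiskerLeft T k.symm ≪≫
    Functor.isoWhiskerRight (asIso adj.unit).symm (P.lift T hT)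

end Coreflection

/-! ### Exact adjunctions and derived categories -/

/-- The adjunction induced on categories of complexes by an adjunction of additive functors. -/
def Adjunction.mapHomologicalComplex {V W : Type*} [Category* V] [Category* W] [Preadditive V]
    [Preadditive W] {F : V ⥤ W} {G : W ⥤ V} (adj : F ⊣ G) [F.Additive] [G.Additive]
    {ι : Type*} (c : ComplexShape ι) :
    F.mapHomologicalComplex c ⊣ G.mapHomologicalComplex c where
  unit :=
    { app X := { f n := adj.unit.app (X.X n), comm' _ _ _ := (adj.unit.naturality _).symm }
      naturality _ _ _ := by ext; exact adj.unit.naturality _ }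
  counit :=
    { app X := { f n := adj.counit.app (X.X n), comm' _ _ _ := (adj.counit.naturality _).symm }
      naturality _ _ _ := by ext; exact adj.counit.naturality _ }
  left_triangle_components X := by ext; exact adj.left_triangle_components _
  right_triangle_components X := by ext; exact adj.right_triangle_components _

end CategoryTheory

namespace IdempotentedAlgebra

section

variable {C D : Type (u + 1)} [Category.{u} C] [Abelian C] [Category.{u} D] [Abelian D]
  [HasDerivedCategory.{w₁} C] [HasDerivedCategory.{w₂} D]

/-- The total right derived functor of an exact functor. -/
theorem totalRightDerived_iso_of_exact (F : C ⥤ D) [F.Additive]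
    [Limits.PreservesFiniteLimits F] [Limits.PreservesFiniteColimits F]
    [(toDerived F).HasRightDerivedFunctor (HomologicalComplex.quasiIso C (ComplexShape.up ℤ))] :
    Nonempty ((toDerived F).totalRightDerived DerivedCategory.Q
      (HomologicalComplex.quasiIso C (ComplexShape.up ℤ)) ≅ F.mapDerivedCategory) :=
  -- An exact functor preserves quasi-isomorphisms, so its termwise extension is a derived functor;
  -- uniqueness of derived functors gives the isomorphism.
  have := Functor.isRightDerivedFunctor_of_inverts
    (HomologicalComplex.quasiIso C (ComplexShape.up ℤ)) F.mapDerivedCategory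
    F.mapDerivedCategoryFactors
  ⟨Functor.rightDerivedNatIso _ _ ((toDerived F).totalRightDerivedUnit DerivedCategory.Q
      (HomologicalComplex.quasiIso C (ComplexShape.up ℤ))) F.mapDerivedCategoryFactors.inv
    (HomologicalComplex.quasiIso C (ComplexShape.up ℤ)) (Iso.refl _)⟩

/-- The total left derived functor of an exact functor. -/
theorem totalLeftDerived_iso_of_exact (F : C ⥤ D) [F.Additive]
    [Limits.PreservesFiniteLimits F] [Limits.PreservesFiniteColimits F]
    [(toDerived F).HasLeftDerivedFunctor (HomologicalComplex.quasiIso C (ComplexShape.up ℤ))] :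
    Nonempty ((toDerived F).totalLeftDerived DerivedCategory.Q
      (HomologicalComplex.quasiIso C (ComplexShape.up ℤ)) ≅ F.mapDerivedCategory) :=
  have := Functor.isLeftDerivedFunctor_of_inverts
    (HomologicalComplex.quasiIso C (ComplexShape.up ℤ)) F.mapDerivedCategory
    F.mapDerivedCategoryFactors
  ⟨Functor.leftDerivedNatIso _ _ ((toDerived F).totalLeftDerivedCounit DerivedCategory.Q
      (HomologicalComplex.quasiIso C (ComplexShape.up ℤ))) F.mapDerivedCategoryFactors.hom
    (HomologicalComplex.quasiIso C (ComplexShape.up ℤ)) (Iso.refl _)⟩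

/-- The adjunction induced on derived categories by an adjunction of exact functors. -/
noncomputable def mapDerivedAdjunction {F : C ⥤ D} {G : D ⥤ C} (adj : F ⊣ G)
    [F.Additive] [G.Additive]
    [Limits.PreservesFiniteLimits F] [Limits.PreservesFiniteColimits F]
    [Limits.PreservesFiniteLimits G] [Limits.PreservesFiniteColimits G] :
    F.mapDerivedCategory ⊣ G.mapDerivedCategory :=
  -- No resolutions are needed: both functors on complexes preserve quasi-isomorphisms, so the
  -- termwise adjunction descends to the localizations.
  letI : CatCommSq (F.mapHomologicalComplex (ComplexShape.up ℤ)) DerivedCategory.Q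
    DerivedCategory.Q F.mapDerivedCategory := ⟨F.mapDerivedCategoryFactors.symm⟩
  letI : CatCommSq (G.mapHomologicalComplex (ComplexShape.up ℤ)) DerivedCategory.Q
    DerivedCategory.Q G.mapDerivedCategory := ⟨G.mapDerivedCategoryFactors.symm⟩
  (adj.mapHomologicalComplex (ComplexShape.up ℤ)).localization
    DerivedCategory.Q (HomologicalComplex.quasiIso C (ComplexShape.up ℤ))
    DerivedCategory.Q (HomologicalComplex.quasiIso D (ComplexShape.up ℤ)) _ _

/-- A factorization `H ≅ F ⋙ G` of exact functors `C ⥤ D ⥤ C` induces a factorization on derived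
categories. -/
noncomputable def mapDerivedCompIso {F : C ⥤ D} {G : D ⥤ C} {H : C ⥤ C} (i : H ≅ F ⋙ G)
    [F.Additive] [G.Additive] [H.Additive]
    [Limits.PreservesFiniteLimits F] [Limits.PreservesFiniteColimits F]
    [Limits.PreservesFiniteLimits G] [Limits.PreservesFiniteColimits G]
    [Limits.PreservesFiniteLimits H] [Limits.PreservesFiniteColimits H] :
    H.mapDerivedCategory ≅ F.mapDerivedCategory ⋙ G.mapDerivedCategory :=
  letI : Localization.Lifting DerivedCategory.Q
      (HomologicalComplex.quasiIso C (ComplexShape.up ℤ))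
      (F.mapHomologicalComplex (ComplexShape.up ℤ) ⋙
        G.mapHomologicalComplex (ComplexShape.up ℤ) ⋙ DerivedCategory.Q)
      (F.mapDerivedCategory ⋙ G.mapDerivedCategory) :=
    ⟨(Functor.associator _ _ _).symm ≪≫
      Functor.isoWhiskerRight F.mapDerivedCategoryFactors G.mapDerivedCategory ≪≫
      Functor.associator _ _ _ ≪≫
      Functor.isoWhiskerLeft _ G.mapDerivedCategoryFactors⟩
  Localization.liftNatIso DerivedCategory.Q
    (HomologicalComplex.quasiIso C (ComplexShape.up ℤ))
    (H.mapHomologicalComplex (ComplexShape.up ℤ) ⋙ DerivedCategory.Q)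
    (F.mapHomologicalComplex (ComplexShape.up ℤ) ⋙
        G.mapHomologicalComplex (ComplexShape.up ℤ) ⋙ DerivedCategory.Q) _ _
    (Functor.isoWhiskerRight (NatIso.mapHomologicalComplex i _) DerivedCategory.Q)

/-- The identity functor is its own extension to the derived category. -/
noncomputable def mapDerivedIdIso :
    (𝟭 C).mapDerivedCategory ≅ 𝟭 (DerivedCategory C) :=
  Localization.liftNatIso DerivedCategory.Q
    (HomologicalComplex.quasiIso C (ComplexShape.up ℤ))
    ((𝟭 C).mapHomologicalComplex (ComplexShape.up ℤ) ⋙ DerivedCategory.Q) DerivedCategory.Q _ _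
    (Functor.isoWhiskerRight (Functor.mapHomologicalComplexIdIso C _) DerivedCategory.Q)

end

/-! ### The adjunction between `A ⊗_{eAe} -` and `Hom_A(Ae, -)` -/

section

variable {K A : Type u} [CommRing K] [NonUnitalRing A] [Module K A] [IsScalarTower K A A]
  [SMulCommClass K A A] {e : A} (he : IsIdempotentElem e)

theorem isIso_of_bijective [IsIdempotented A] {M N : NDMod K A} (f : M ⟶ N)
    (hf : Function.Bijective (lin f)) : IsIso f := by
  have : IsIso ((nonDegenerate K A).ι.map f) :=
    (ConcreteCategory.isIso_iff_bijective ((nonDegenerate K A).ι.map f)).2 hf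
  exact isIso_of_reflects_iso f (nonDegenerate K A).ι

/-! ### The unit of the adjunction -/

section

variable (N : Type u) [AddCommGroup N] [Module he.Corner N]

theorem tmk_add (a : A) (n n' : N) :
    tmk K he a (n + n') = tmk K he a n + tmk K he a n' := by
  rw [tmk, TensorProduct.tmul_add, Submodule.Quotient.mk_add]

theorem add_tmk (a a' : A) (n : N) :
    tmk K he (a + a') n = tmk K he a n + tmk K he a' n := by
  rw [tmk, TensorProduct.add_tmul, Submodule.Quotient.mk_add]

variable (K) in
/-- The map `N → Hom_A(Ae, A ⊗_{eAe} N)` sending `n` to `a ↦ a ⊗ n`. -/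
def tensorUnit : N →ₗ[he.Corner] (leftIdeal K e →ₗ[Unitization K A] tensorObj K he N) where
  toFun n :=
    { toFun := fun a => tmk K he a.1 n
      map_add' := fun a b => add_tmk he N a.1 b.1 n
      map_smul' := fun _ _ => rfl }
  map_add' n n' := LinearMap.ext fun a => tmk_add he N a.1 n n'
  map_smul' x n := LinearMap.ext fun a => (tmk_mul he a.1 x n).symm

/-- Evaluation at `e` identifies the map with `n ↦ e ⊗ n`, and `cornerMap he N e`, which kills the
tensor relations, recovers `n` from `e ⊗ n`. -/
theorem tensorUnit_bijective : Function.Bijective (tensorUnit K he N) := by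
  constructor
  · refine (injective_iff_map_eq_zero _).2 fun n hn => ?_
    have h : tmk K he e n = 0 := LinearMap.congr_fun hn ⟨e, self_mem_leftIdeal he⟩
    have h' := cornerMap_eq_zero (K := K) he N e _ ((Submodule.Quotient.mk_eq_zero _).1 h)
    rw [cornerMap_tmul] at h'
    have h1 : toCorner he (e * e) = 1 := Subtype.ext (by
      change e * (e * e) * e = e
      simp only [he.eq])
    rwa [h1, one_smul] at h'
  · intro φ
    obtain ⟨z, hz⟩ := Submodule.Quotient.mk_surjective _ (φ ⟨e, self_mem_leftIdeal he⟩)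
    -- The preimage is forced by `φ(e) = eφ(e)` and the formula `smul_eq_tmk` for the action of `e`
    -- on the class of `z`; the values at other `a ∈ Ae` follow from `a = ae`.
    refine ⟨cornerMap he N e z, LinearMap.ext fun a => ?_⟩
    have h1 : tmk K he e (cornerMap he N e z) = φ ⟨e, self_mem_leftIdeal he⟩ := by
      rw [← smul_eq_tmk, hz, ← map_smul]
      congr 1
      refine Subtype.ext ?_
      change (e : Unitization K A) • e = e
      rw [inr_smul_self, he.eq]
    have h2 : a = ((a.1 : A) : Unitization K A) •
        (⟨e, self_mem_leftIdeal he⟩ : leftIdeal K e) := Subtype.ext (by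
      change a.1 = (a.1 : Unitization K A) • e
      rw [inr_smul_self, mul_eq_of_mem_leftIdeal he a.2])
    conv_rhs => rw [h2, map_smul, ← h1, smul_tmk, mul_eq_of_mem_leftIdeal he a.2]
    rfl

end

/-! ### The counit of the adjunction, its image and its kernel -/

section

variable (M : Type u) [AddCommGroup M] [Module (Unitization K A) M]

/-- The bilinear map `A × Hom_A(Ae, M) → M` sending `(a, φ)` to `aφ(e)`. -/
def evalMap : TensorProduct ℤ A (leftIdeal K e →ₗ[Unitization K A] M) →ₗ[Unitization K A] M :=
  TensorProduct.AlgebraTensorModule.lift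
    { toFun := fun a => AddMonoidHom.toIntLinearMap
        { toFun := fun φ : leftIdeal K e →ₗ[Unitization K A] M =>
            (a : Unitization K A) • φ ⟨e, self_mem_leftIdeal he⟩
          map_zero' := smul_zero _
          map_add' := fun φ ψ => smul_add _ _ _ }
      map_add' := fun a b => LinearMap.ext fun φ => by
        change ((a + b : A) : Unitization K A) • φ _ = _
        rw [Unitization.inr_add, add_smul]; rfl
      map_smul' := fun r a => LinearMap.ext fun φ => by
        change ((r • a : A) : Unitization K A) • φ ⟨e, self_mem_leftIdeal he⟩ =
          r • (a : Unitization K A) • φ ⟨e, self_mem_leftIdeal he⟩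
        rw [← mul_smul]
        congr 1
        refine Unitization.ext (by simp) ?_
        change r.fst • a + r.snd * a = _
        simp }

/-- The map `A ⊗_{eAe} Hom_A(Ae, M) → M` sending `a ⊗ φ` to `aφ(e)`. -/
def tensorCounit :
    tensorObj K he (leftIdeal K e →ₗ[Unitization K A] M) →ₗ[Unitization K A] M :=
  (tensorRel K he _).liftQ (evalMap he M) (by
    refine Submodule.span_le.2 ?_
    rintro _ ⟨a, x, φ, rfl⟩
    change evalMap he M _ = 0
    rw [map_sub, sub_eq_zero]
    change ((a * x.1 : A) : Unitization K A) • φ ⟨e, _⟩ =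
      (a : Unitization K A) • φ (rightMulCorner K x ⟨e, _⟩)
    -- Both sides equal `aφ(x)`, since `xe = x = ex` for `x ∈ eAe`.
    rw [Unitization.inr_mul, mul_smul, ← map_smul φ]
    congr 2
    refine Subtype.ext ?_
    change (x.1 : Unitization K A) • e = e * x.1
    obtain ⟨h1, h2⟩ := (Subsemigroup.mem_corner_iff he).1 x.2
    rw [inr_smul_self, h1, h2])

theorem tensorCounit_tmk (a : A) (φ : leftIdeal K e →ₗ[Unitization K A] M) :
    tensorCounit he M (tmk K he a φ) =
      (a : Unitization K A) • φ ⟨e, self_mem_leftIdeal he⟩ := rfl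

end

theorem range_tensorCounit (M : NDMod K A) :
    LinearMap.range (tensorCounit he M.obj) = genSubmodule K e M.obj := by
  apply le_antisymm
  · rintro _ ⟨z, rfl⟩
    induction z using tensorObj_induction he with
    | h0 => rw [map_zero]; exact zero_mem _
    | ha y z hy hz => rw [map_add]; exact add_mem hy hz
    | ht a φ =>
      -- It suffices to treat `φ(e)`, which is `(ee)φ(e)` and so one of the generators of `AeM`.
      refine Submodule.smul_mem _ _ (Submodule.subset_span
        ⟨e, φ ⟨e, self_mem_leftIdeal he⟩, ?_⟩)
      rw [← map_smul]
      congr 1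
      refine Subtype.ext ?_
      change e = ((e * e : A) : Unitization K A) • e
      rw [inr_smul_self, he.eq, he.eq]
  · refine Submodule.span_le.2 ?_
    rintro _ ⟨a, m, rfl⟩
    -- The generator `(ae)m` is the image of `a ⊗ φ`, where `φ` is the action on `m`, so that `φ(e)
    -- = em`.
    let φ : leftIdeal K e →ₗ[Unitization K A] M.obj :=
      { toFun := fun y => (y.1 : Unitization K A) • m
        map_add' := fun y z => by
          rw [Submodule.coe_add, Unitization.inr_add, add_smul]
        map_smul' := fun r y => by
          rw [RingHom.id_apply, ← mul_smul]
          congr 1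
          refine Unitization.ext (by simp) ?_
          change r.fst • y.1 + r.snd * y.1 = _
          simp }
    refine ⟨tmk K he a φ, ?_⟩
    rw [tensorCounit_tmk]
    change (a : Unitization K A) • (e : Unitization K A) • m = _
    rw [← mul_smul, ← Unitization.inr_mul]

/-- Any `ez` has the form `e ⊗ ψ`. If the counit kills `z`, it kills `ez`, so `eψ(e) = 0`; as every
`y ∈ Ae` is `y · e · e`, this gives `ψ = 0`. -/
theorem smul_eq_zero_of_tensorCounit_eq_zero {M : Type u} [AddCommGroup M]
    [Module (Unitization K A) M]
    (z : tensorObj K he (leftIdeal K e →ₗ[Unitization K A] M)) (hz : tensorCounit he M z = 0) :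
    (e : Unitization K A) • z = 0 := by
  obtain ⟨z, rfl⟩ := Submodule.Quotient.mk_surjective _ z
  have h1 : tensorCounit he M ((e : Unitization K A) •
      (Submodule.Quotient.mk z : tensorObj K he (leftIdeal K e →ₗ[Unitization K A] M))) = 0 := by
    rw [map_smul, hz, smul_zero]
  rw [smul_eq_tmk, tensorCounit_tmk] at h1
  have h2 : cornerMap he (leftIdeal K e →ₗ[Unitization K A] M) e z = 0 := by
    refine LinearMap.ext fun y => ?_
    have h3 : y = ((y.1 : A) : Unitization K A) • (e : Unitization K A) •
        (⟨e, self_mem_leftIdeal he⟩ : leftIdeal K e) := Subtype.ext (by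
      change y.1 = (y.1 : Unitization K A) • (e : Unitization K A) • e
      rw [inr_smul_self, inr_smul_self, he.eq, mul_eq_of_mem_leftIdeal he y.2])
    rw [h3, map_smul, map_smul, h1, smul_zero, LinearMap.zero_apply]
  rw [smul_eq_tmk, h2, tmk, TensorProduct.tmul_zero, Submodule.Quotient.mk_zero]

/-- The kernel is a submodule of `THM = Ae(THM)` annihilated by `e`, and left speciality says that
such a submodule is generated by its `e`-part, which is zero. -/
theorem tensorCounit_injective [IsIdempotented A] (hs : LeftSpecial K e) (M : NDMod K A) :
    Function.Injective (tensorCounit (K := K) he M.obj) := by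
  refine LinearMap.ker_eq_bot.1 (le_bot_iff.1 ?_)
  refine hs.le_of_smul_mem he ((tensor K he).obj ((homAe K he).obj M)) _ ⊥ ?_ fun z hz =>
    (Submodule.mem_bot _).2 (smul_eq_zero_of_tensorCounit_eq_zero he z hz)
  rw [tensorObj_generated he]
  exact le_top

/-- The map `g` is postcomposition with `f`. It is left abstract, subject to `hg`, so that the
action of `homAe` on a morphism can be substituted for it. -/
theorem tensorCounit_naturality {M M' : Type u} [AddCommGroup M] [Module (Unitization K A) M]
    [AddCommGroup M'] [Module (Unitization K A) M'] (f : M →ₗ[Unitization K A] M')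
    (g : (leftIdeal K e →ₗ[Unitization K A] M) →ₗ[he.Corner]
      (leftIdeal K e →ₗ[Unitization K A] M')) (hg : ∀ φ, g φ = f ∘ₗ φ)
    (z : tensorObj K he (leftIdeal K e →ₗ[Unitization K A] M)) :
    tensorCounit he M' (tensorMap K he g z) = f (tensorCounit he M z) := by
  induction z using tensorObj_induction he with
  | h0 => simp only [map_zero]
  | ha y z hy hz => simp only [map_add, hy, hz]
  | ht a φ =>
    rw [tensorMap_tmk, tensorCounit_tmk, tensorCounit_tmk, hg, map_smul, LinearMap.comp_apply]

/-! ### The adjunction in `M(A)` and the isomorphism of `Γ_e` with `A ⊗_{eAe} Hom_A(Ae, -)` -/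

variable [IsIdempotented A]

/-- `A ⊗_{eAe} -` is left adjoint to `Hom_A(Ae, -)`. -/
def tensorHomAdjunction : tensor K he ⊣ homAe K he where
  unit :=
    { app N := ModuleCat.ofHom (tensorUnit K he N)
      naturality _ _ _ := rfl }
  counit :=
    { app M := ObjectProperty.homMk (ModuleCat.ofHom (tensorCounit he M.obj))
      naturality _ _ f := ObjectProperty.hom_ext _ (ModuleCat.hom_ext (LinearMap.ext fun z =>
        tensorCounit_naturality he f.hom.hom _ (fun _ => rfl) z)) }
  left_triangle_components N := ObjectProperty.hom_ext _ (ModuleCat.hom_ext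
    (LinearMap.ext fun (z : tensorObj K he N) => by
      change tensorCounit he (tensorObj K he N) (tensorMap K he (tensorUnit K he N) z) = z
      induction z using tensorObj_induction he with
      | h0 => simp only [map_zero]
      | ha y z hy hz => simp only [map_add, hy, hz]
      | ht a n =>
        rw [tensorMap_tmk, tensorCounit_tmk]
        change (a : Unitization K A) • tmk K he e n = _
        rw [smul_tmk]
        exact (tmk_mul he a (1 : he.Corner) n).trans (by rw [one_smul])))
  right_triangle_components M := ModuleCat.hom_ext (LinearMap.ext fun
      (φ : leftIdeal K e →ₗ[Unitization K A] M.obj) => LinearMap.ext fun y => by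
    change (y.1 : Unitization K A) • φ ⟨e, self_mem_leftIdeal he⟩ = φ y
    rw [← map_smul]
    congr 1
    refine Subtype.ext ?_
    change (y.1 : Unitization K A) • e = y.1
    rw [inr_smul_self, mul_eq_of_mem_leftIdeal he y.2])

instance : IsIso (tensorHomAdjunction (K := K) he).unit := by
  have (N : ModuleCat.{u} he.Corner) : IsIso ((tensorHomAdjunction (K := K) he).unit.app N) :=
    (ConcreteCategory.isIso_iff_bijective _).2 (tensorUnit_bijective he N)
  exact NatIso.isIso_of_isIso_app _

/-- The counit `A ⊗_{eAe} Hom_A(Ae, M) → M`, with values in `AeM`. -/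
def tensorHomToGamma : homAe K he ⋙ tensor K he ⟶ gamma K e where
  app M := ObjectProperty.homMk (ModuleCat.ofHom
    ((tensorCounit he M.obj).codRestrict (genSubmodule K e M.obj) fun z =>
      (range_tensorCounit he M).le ⟨z, rfl⟩))
  naturality _ _ f := ObjectProperty.hom_ext _ (ModuleCat.hom_ext (LinearMap.ext fun z =>
    Subtype.ext (tensorCounit_naturality he f.hom.hom _ (fun _ => rfl) z)))

theorem isIso_tensorHomToGamma (hs : LeftSpecial K e) :
    IsIso (tensorHomToGamma (K := K) he) := by
  have (M : NDMod K A) : IsIso ((tensorHomToGamma (K := K) he).app M) := by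
    refine isIso_of_bijective _ ⟨fun x y h => tensorCounit_injective he hs M
      (congrArg Subtype.val h), ?_⟩
    rintro ⟨m, hm⟩
    obtain ⟨z, hz⟩ := (range_tensorCounit he M).ge hm
    exact ⟨z, Subtype.ext hz⟩
  exact NatIso.isIso_of_isIso_app _

end

end IdempotentedAlgebra

/-! ### Passage to the derived categories -/

/-- For `e` left special and left split, `Γ_e` and `A ⊗^L_{eAe} -` take values in `D(A)_e`; the
outer arrows of the triangle with vertices `D(A)`, `D(A)_e`, `D(eAe)` are left adjoint to the inner
ones, the triangle commutes, and `RHom_A(Ae, -) : D(A)_e ⥤ D(eAe)` is an equivalence with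
quasi-inverse `A ⊗^L_{eAe} -`. -/
theorem theorem3p23 {K A : Type u} [CommRing K] [NonUnitalRing A] [Module K A]
    [IsScalarTower K A A] [SMulCommClass K A A] [IsIdempotented A] {e : A}
    (he : IsIdempotentElem e)
    [HasDerivedCategory.{w₁} (NDMod K A)]
    [HasDerivedCategory.{w₂} (ModuleCat.{u} he.Corner)]
    (hspecial : LeftSpecial K e)
    (hsplit : LeftSplit K e) :
    ∃ (hΓ : ∀ M, isDerivedSupported he hspecial ((derivedGamma he hspecial).obj M))
      (hT : ∀ N : DerivedCategory (ModuleCat.{u} he.Corner),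
        isDerivedSupported he hspecial ((derivedTensor he hspecial).obj N)),
      Nonempty ((isDerivedSupported he hspecial).ι ⊣
        (isDerivedSupported he hspecial).lift (derivedGamma he hspecial) hΓ) ∧
      Nonempty ((derivedTensor he hspecial : DerivedCategory (ModuleCat.{u} he.Corner) ⥤ _) ⊣
        derivedHom K he) ∧
      Nonempty ((isDerivedSupported he hspecial).lift (derivedTensor he hspecial) hT ⊣
        (isDerivedSupported he hspecial).ι ⋙ derivedHom K he) ∧
      Nonempty ((isDerivedSupported he hspecial).lift (derivedGamma he hspecial) hΓ ⋙
        (isDerivedSupported he hspecial).ι ⋙ derivedHom K he ≅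
          (derivedHom K he : _ ⥤ DerivedCategory (ModuleCat.{u} he.Corner))) ∧
      Nonempty ((isDerivedSupported he hspecial).lift (derivedTensor he hspecial) hT ⋙
        (isDerivedSupported he hspecial).ι ≅ derivedTensor he hspecial) ∧
      Nonempty (derivedTensor he hspecial ⋙
        (isDerivedSupported he hspecial).lift (derivedGamma he hspecial) hΓ ≅
          (isDerivedSupported he hspecial).lift (derivedTensor he hspecial) hT) ∧
      ∃ E : DerivedSupported he hspecial ≌ DerivedCategory (ModuleCat.{u} he.Corner),
        E.functor = (isDerivedSupported he hspecial).ι ⋙ derivedHom K he ∧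
        E.inverse = (isDerivedSupported he hspecial).lift (derivedTensor he hspecial) hT := by
  have := (preservesFinite_of_exact _ (gamma_exact hspecial he)).1
  have := (preservesFinite_of_exact _ (gamma_exact hspecial he)).2
  have := (preservesFinite_of_exact _ (homAe_exact (K := K) he)).1
  have := (preservesFinite_of_exact _ (homAe_exact (K := K) he)).2
  have := (preservesFinite_of_exact _ (tensor_exact hspecial he)).1
  have := (preservesFinite_of_exact _ (tensor_exact hspecial he)).2
  have := hasRightDerivedFunctor_of_exact.{u, w₁, w₂} _ (homAe_exact (K := K) he)
  have := hasLeftDerivedFunctor_of_exact.{u, w₂, w₁} _ (tensor_exact hspecial he)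
  have := isIso_tensorHomToGamma he hspecial
  obtain ⟨iH⟩ := totalRightDerived_iso_of_exact.{u, w₁, w₂} (homAe K he)
  obtain ⟨iT⟩ := totalLeftDerived_iso_of_exact.{u, w₂, w₁} (tensor K he)
  change derivedHom K he ≅ _ at iH
  change derivedTensor he hspecial ≅ _ at iT
  let adj : derivedTensor he hspecial ⊣ derivedHom K he :=
    ((mapDerivedAdjunction.{u, w₂, w₁} (tensorHomAdjunction (K := K) he)).ofNatIsoLeft
      iT.symm).ofNatIsoRight iH.symm
  -- Any isomorphism of the composite `A ⊗^L_{eAe} -` followed by `RHom_A(Ae, -)` with the identity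
  -- makes the unit invertible, so the derived unit need not be computed; the one used is induced by
  -- the underived unit.
  have : IsIso adj.unit := adj.isIso_unit_of_iso
    (NatIso.hcomp iT iH ≪≫
      (mapDerivedCompIso.{u, w₂, w₁} (asIso (tensorHomAdjunction (K := K) he).unit)).symm ≪≫
      mapDerivedIdIso)
  let i : derivedGamma he hspecial ≅ derivedHom K he ⋙ derivedTensor he hspecial :=
    mapDerivedCompIso.{u, w₁, w₂} (asIso (tensorHomToGamma (K := K) he)).symm ≪≫
      (NatIso.hcomp iH iT).symm
  -- The `rfl` holds because `D(A)_e` is by definition `isoFixed` of the derived `Γ_e`.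
  obtain ⟨hΓ, hT, h⟩ := exists_equivalence_of_adj adj i rfl
  exact ⟨hΓ, hT, h.1, ⟨adj⟩, h.2⟩
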